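/- For $n\ge 3$ let $B_n=\mathrm{Cay}(S_n,S)$ be the bubble-sort graph of dimension $n$, where $S=\{(1\,2),(2\,3),\dots,(n{-}1\;n)\}$: its vertices are the permutations of $\{1,\dots,n\}$, and $x$ is adjacent to $sx$ for every $s\in S$. An $r$-distinguishing labelling of a graph $G$ is a map from its vertices to $\{1,\dots,r\}$ that is preserved by no non-identity automorphism of $G$, and the distinguishing number $D(G)$ is the least $r$ for which one exists. Let $T(S)$ be the graph on $\{1,\dots,n\}$ in which $i,j$ are adjacent if and only if $(i\,j)\in S$ (a path). Theorem. For every $n\ge 3$: (1) $D(B_n)=2$. (2) If $n\ge 4$, the labelling of the vertices of $B_n$ that gives label $1$ to the cycles $(1\,2),(1\,2\,3),\dots,(1\,2\cdots n)$ and label $2$ to all other permutations is $2$-distinguishing. (3) $\mathrm{Aut}(B_n)$ is the direct product of the right regular representation of $S_n$ and $\mathrm{Aut}(T(S))$ acting by left multiplication: assigning to $(a,b)\in S_n\times\mathrm{Aut}(T(S))$ the map $x\mapsto b\,x\,a^{-1}$ is a group isomorphism $S_n\times \mathrm{Aut}(T(S))\to \mathrm{Aut}(B_n)$. -/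

import Mathlib

/-- The Cayley graph `Cay(H, S)`: every `h` is joined to `s * h` for `s ∈ S`
(loops, which would come from `1 ∈ S`, are dropped). -/
def cayleyGraph {H : Type*} [Group H] (S : Set H) : SimpleGraph H :=
  SimpleGraph.fromRel (fun g h => ∃ s ∈ S, h = s * g)

/-- `φ` is an `r`-distinguishing labelling of the vertices of `G`: its labels lie in `{1, …, r}` and
every non-identity automorphism of `G` changes the label of some vertex. -/
def IsDistinguishingLabelling {V : Type*} (G : SimpleGraph V) (r : ℕ) (φ : V → ℕ) : Prop :=
  (∀ x, φ x ∈ Finset.Icc 1 r) ∧ ∀ σ : G ≃g G, σ ≠ 1 → ∃ x, φ x ≠ φ (σ x)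

/-- The distinguishing number `D(G)`: the least `r` for which `G` has an `r`-distinguishing
labelling. (For a finite graph such an `r` exists.) -/
noncomputable def distinguishingNumber {V : Type*} (G : SimpleGraph V) : ℕ :=
  sInf {r : ℕ | ∃ φ : V → ℕ, IsDistinguishingLabelling G r φ}

/-- The adjacent transpositions `(1 2), (2 3), …, (n-1 n)`; the points `1, …, n` are
the elements `0, …, n - 1` of `Fin n`. -/
def adjacentTranspositions (n : ℕ) : Set (Equiv.Perm (Fin n)) :=
  {s | ∃ i j : Fin n, (i : ℕ) + 1 = (j : ℕ) ∧ s = Equiv.swap i j}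

/-- The transposition graph `T(S)` of a set `S` of transpositions. -/
def transpositionGraph {n : ℕ} (S : Set (Equiv.Perm (Fin n))) : SimpleGraph (Fin n) :=
  SimpleGraph.fromRel (fun i j => Equiv.swap i j ∈ S)

/-- The bubble-sort graph `B_n`. -/
def bubbleSortGraph (n : ℕ) : SimpleGraph (Equiv.Perm (Fin n)) :=
  cayleyGraph (adjacentTranspositions n)

/-- Label `1` on the cycles `(1 2), (1 2 3), …, (1 2 ⋯ n)`, label `2` on all other permutations.
Here `Fin.cycleRange i` is the cycle `0 ↦ 1 ↦ ⋯ ↦ i ↦ 0` fixing all points above `i`. -/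
def bubbleSortLabelling (n : ℕ) (x : Equiv.Perm (Fin n)) : ℕ :=
  if ∃ i : Fin n, 1 ≤ (i : ℕ) ∧ x = Fin.cycleRange i then 1 else 2

/-! Write n = k + 1 and let s_i be the adjacent transpositions. An automorphism σ sends the edge
from x to s_i x to an edge at σ x, hence induces an injection p of the generators at every vertex x.
Two generators span a 4-cycle exactly when they commute, and σ maps such squares to squares
(`Far.map`). So p is an automorphism of the path of generators: the identity or the reversal
(`actsLocally_id_or_rev`).

The choice is the same at all vertices (`ActsLocally.adjSwap_mul`): comparing the two ends of an
edge settles it unless the edge carries the middle generator, where a square or, for k = 3, a braid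
hexagon decides. Since the s_i generate the group, σ x = b x a⁻¹ with b trivial or order-reversing
(`exists_eq_mul_mul_inv`). This gives surjectivity in (3); injectivity is the triviality of the
centre of S_n.

For the labelling, b x a⁻¹ would have to permute the cycles labelled 1. Their inverses move each
nonzero point down by at most one, which forces a = 1 if b = 1 and is impossible for injective a if
b is the reversal. -/

/-! ### Adjacent transpositions and their products -/

/-- The transposition exchanging the consecutive points `i` and `i + 1`. -/
def adjSwap {k : ℕ} (i : Fin k) : Equiv.Perm (Fin (k + 1)) :=
  Equiv.swap i.castSucc i.succ

variable {k : ℕ}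

theorem adjSwap_val (i : Fin k) (v : Fin (k + 1)) :
    (adjSwap i v : ℕ) =
      if (v : ℕ) = i then (i : ℕ) + 1 else if (v : ℕ) = i + 1 then (i : ℕ) else v := by
  simp only [adjSwap, Equiv.swap_apply_def, Fin.ext_iff, Fin.val_castSucc, Fin.val_succ]
  split_ifs <;> simp

@[simp]
theorem adjSwap_mul_self (i : Fin k) : adjSwap i * adjSwap i = 1 :=
  Equiv.swap_mul_self _ _

@[simp]
theorem adjSwap_mul_self_mul (i : Fin k) (x : Equiv.Perm (Fin (k + 1))) :
    adjSwap i * (adjSwap i * x) = x := by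
  rw [← mul_assoc, adjSwap_mul_self, one_mul]

theorem adjSwap_ne_one (i : Fin k) : adjSwap i ≠ 1 := by
  intro h
  have := adjSwap_val i i.castSucc
  rw [h] at this
  simp at this

theorem adjSwap_injective : Function.Injective (adjSwap (k := k)) := by
  intro i j h
  have hi := adjSwap_val i i.castSucc
  rw [h, adjSwap_val] at hi
  ext
  simp only [Fin.val_castSucc] at hi
  split_ifs at hi <;> omega

/-- The product of two distinct adjacent transpositions moves a point upwards across the gap
between `t` and `t + 1` exactly for the two gaps exchanged by the factors. -/
theorem exists_adjSwap_crossing_iff {i j : Fin k} (hij : i ≠ j) (t : ℕ) :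
    (∃ v : Fin (k + 1), (v : ℕ) ≤ t ∧ t < (adjSwap j (adjSwap i v) : ℕ)) ↔ t = i ∨ t = j := by
  have hne : (i : ℕ) ≠ j := fun h => hij (Fin.ext h)
  constructor
  · rintro ⟨v, hv, ht⟩
    simp only [adjSwap_val] at ht
    split_ifs at ht <;> omega
  · rintro (rfl | rfl)
    · refine ⟨i.castSucc, by simp, ?_⟩
      simp only [adjSwap_val, Fin.val_castSucc]
      split_ifs <;> omega
    · refine ⟨adjSwap i j.castSucc, ?_, ?_⟩
      · simp only [adjSwap_val, Fin.val_castSucc]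
        split_ifs <;> omega
      · rw [← Equiv.Perm.mul_apply (adjSwap i), adjSwap_mul_self]
        simp [adjSwap_val]

/-- The product determines the set of gaps that it crosses upwards, and this set is the pair of
factors. If a = b the product is 1 and crosses nothing. -/
theorem eq_or_eq_of_adjSwap_mul_eq {i j a b : Fin k} (hij : i ≠ j)
    (h : adjSwap b * adjSwap a = adjSwap j * adjSwap i) :
    (a = i ∧ b = j) ∨ (a = j ∧ b = i) := by
  have hab : a ≠ b := by
    rintro rfl
    obtain ⟨v, hv, hv'⟩ := (exists_adjSwap_crossing_iff hij i).2 (Or.inl rfl)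
    rw [← Equiv.Perm.mul_apply, ← h, adjSwap_mul_self, Equiv.Perm.one_apply] at hv'
    omega
  have key (t : ℕ) : (t = a ∨ t = b) ↔ (t = i ∨ t = j) := by
    rw [← exists_adjSwap_crossing_iff hab, ← exists_adjSwap_crossing_iff hij]
    simp only [← Equiv.Perm.mul_apply, h]
  have hi := key i
  have hj := key j
  simp only [Fin.ext_iff]
  rw [ne_eq, Fin.ext_iff] at hab hij
  omega

/-- The gaps `i` and `j` are not equal or adjacent. -/
def Far (i j : Fin k) : Prop :=
  (i : ℕ) + 1 < j ∨ (j : ℕ) + 1 < i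

theorem Far.ne {i j : Fin k} (h : Far i j) : i ≠ j := by
  rintro rfl
  unfold Far at h
  omega

theorem Far.comm {i j : Fin k} (h : Far i j) :
    adjSwap i * adjSwap j = adjSwap j * adjSwap i := by
  ext v
  unfold Far at h
  simp only [Equiv.Perm.mul_apply, adjSwap_val]
  split_ifs <;> omega

theorem far_of_comm {i j : Fin k} (hij : i ≠ j)
    (h : adjSwap i * adjSwap j = adjSwap j * adjSwap i) : Far i j := by
  have hne : (i : ℕ) ≠ j := fun h => hij (Fin.ext h)
  have h1 := congrArg (fun f : Equiv.Perm (Fin (k + 1)) => (f i.castSucc : ℕ)) h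
  have h2 := congrArg (fun f : Equiv.Perm (Fin (k + 1)) => (f j.castSucc : ℕ)) h
  unfold Far
  simp only [Equiv.Perm.mul_apply, adjSwap_val, Fin.val_castSucc] at h1 h2
  split_ifs at h1 h2 <;> omega

theorem mem_adjacentTranspositions_iff (s : Equiv.Perm (Fin (k + 1))) :
    s ∈ adjacentTranspositions (k + 1) ↔ ∃ i : Fin k, s = adjSwap i := by
  constructor
  · rintro ⟨i, j, hij, rfl⟩
    refine ⟨⟨i, by omega⟩, ?_⟩
    unfold adjSwap
    congr 1
    ext
    simp [hij]
  · rintro ⟨i, rfl⟩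
    exact ⟨i.castSucc, i.succ, by simp, rfl⟩

/-! ### Edges and squares of the bubble-sort graph -/

theorem bubbleSortGraph_adj (x y : Equiv.Perm (Fin (k + 1))) :
    (bubbleSortGraph (k + 1)).Adj x y ↔ ∃ i : Fin k, y = adjSwap i * x := by
  simp only [bubbleSortGraph, cayleyGraph, SimpleGraph.fromRel_adj,
    mem_adjacentTranspositions_iff]
  constructor
  · rintro ⟨-, ⟨_, ⟨i, rfl⟩, h⟩ | ⟨_, ⟨i, rfl⟩, rfl⟩⟩
    · exact ⟨i, h⟩
    · exact ⟨i, by simp⟩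
  · rintro ⟨i, rfl⟩
    refine ⟨fun h => adjSwap_ne_one i ?_, Or.inl ⟨_, ⟨i, rfl⟩, rfl⟩⟩
    simpa using h

theorem exists_map_adjSwap_mul (σ : bubbleSortGraph (k + 1) ≃g bubbleSortGraph (k + 1))
    (x : Equiv.Perm (Fin (k + 1))) (i : Fin k) :
    ∃ j : Fin k, σ (adjSwap i * x) = adjSwap j * σ x :=
  (bubbleSortGraph_adj _ _).1 (σ.map_adj_iff.2 ((bubbleSortGraph_adj _ _).2 ⟨i, rfl⟩))

/-- An automorphism maps the square spanned by two commuting generators to such a square. -/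
theorem Far.map {σ : bubbleSortGraph (k + 1) ≃g bubbleSortGraph (k + 1)}
    {x : Equiv.Perm (Fin (k + 1))} {i j i' j' : Fin k} (hij : Far i j)
    (hi : σ (adjSwap i * x) = adjSwap i' * σ x) (hj : σ (adjSwap j * x) = adjSwap j' * σ x) :
    Far i' j' ∧ σ (adjSwap j * (adjSwap i * x)) = adjSwap j' * (adjSwap i' * σ x) := by
  have hne' : i' ≠ j' := by
    rintro rfl
    exact hij.ne (adjSwap_injective (mul_right_cancel (σ.injective (hi.trans hj.symm))))
  obtain ⟨a, ha⟩ := exists_map_adjSwap_mul σ (adjSwap i * x) j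
  obtain ⟨b, hb⟩ := exists_map_adjSwap_mul σ (adjSwap j * x) i
  rw [hi] at ha
  rw [hj] at hb
  have hsq : adjSwap j * (adjSwap i * x) = adjSwap i * (adjSwap j * x) := by
    rw [← mul_assoc, ← mul_assoc, hij.comm]
  have h : adjSwap a * adjSwap i' = adjSwap b * adjSwap j' := by
    apply mul_right_cancel (b := σ x)
    rw [mul_assoc, mul_assoc, ← ha, ← hb, hsq]
  -- If a = i', the image path would return to σ x after two steps, although s_j s_i x ≠ x.
  have hz : a ≠ i' := by
    rintro rfl
    rw [adjSwap_mul_self_mul] at ha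
    have := σ.injective ha
    rw [← mul_assoc, mul_eq_right] at this
    refine hij.ne (adjSwap_injective (mul_right_cancel (b := adjSwap i) ?_))
    rw [this, adjSwap_mul_self]
  -- By unique factorization of s_a s_i' = s_b s_j', the image square closes up only with a = j' and
  -- b = i'.
  by_cases hab : a = j'
  · subst hab
    refine ⟨far_of_comm hne' ?_, ha⟩
    rcases eq_or_eq_of_adjSwap_mul_eq hne' h.symm with h' | h'
    · exact absurd h'.1.symm hne'
    · rw [h, h'.2]
  · rcases eq_or_eq_of_adjSwap_mul_eq (a := j') (b := b) hz.symm h.symm with h' | h'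
    · exact absurd h'.1 hne'.symm
    · exact absurd h'.1.symm hab

/-! ### The local action on generators -/

/-- Near `x`, the automorphism `σ` permutes the generators according to `p`. -/
def ActsLocally (σ : bubbleSortGraph (k + 1) ≃g bubbleSortGraph (k + 1)) (p : Fin k → Fin k)
    (x : Equiv.Perm (Fin (k + 1))) : Prop :=
  ∀ i, σ (adjSwap i * x) = adjSwap (p i) * σ x

/-- An injective self-map of `Fin k` that never pulls a neighbouring pair apart is the identity or
the reversal. -/
theorem eq_id_or_rev {p : Fin k → Fin k} (hp : Function.Injective p)
    (h : ∀ i j, Far (p i) (p j) → Far i j) : p = id ∨ p = Fin.rev := by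
  have step (i : ℕ) (hi : i + 1 < k) :
      (p ⟨i + 1, hi⟩ : ℕ) = p ⟨i, by omega⟩ + 1 ∨ (p ⟨i, by omega⟩ : ℕ) = p ⟨i + 1, hi⟩ + 1 := by
    have h1 := h ⟨i, by omega⟩ ⟨i + 1, hi⟩
    have h2 : (p ⟨i, by omega⟩ : ℕ) ≠ p ⟨i + 1, hi⟩ := fun e => by
      have := hp (Fin.ext e)
      simp at this
    simp only [Far] at h1
    omega
  -- Injectivity forbids turning back, so the direction of the first step persists.
  have ne2 (i : ℕ) (hi : i + 1 + 1 < k) : (p ⟨i, by omega⟩ : ℕ) ≠ p ⟨i + 1 + 1, hi⟩ := fun e => by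
    have := hp (Fin.ext e)
    simp at this
    omega
  rcases Nat.lt_or_ge 1 k with hk | hk
  · rcases step 0 hk with h0 | h0
    · have all (i : ℕ) : ∀ hi : i + 1 < k, (p ⟨i + 1, hi⟩ : ℕ) = p ⟨i, by omega⟩ + 1 := by
        induction i with
        | zero => exact fun _ => h0
        | succ i ih =>
          intro hi
          have := ih (by omega)
          have := step (i + 1) hi
          have := ne2 i hi
          omega
      have val (i : ℕ) : ∀ hi : i < k, (p ⟨i, hi⟩ : ℕ) = p ⟨0, by omega⟩ + i := by
        induction i with
        | zero => simp
        | succ i ih => intro hi; rw [all i hi, ih]; omega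
      left
      funext i
      have h1 := val i i.2
      -- The last value p 0 + (k - 1) is below k, so p 0 = 0.
      have h2 := val (k - 1) (by omega)
      have h3 := (p ⟨k - 1, by omega⟩).2
      ext
      rw [Fin.eta] at h1
      rw [id]
      omega
    · have all (i : ℕ) : ∀ hi : i + 1 < k, (p ⟨i, by omega⟩ : ℕ) = p ⟨i + 1, hi⟩ + 1 := by
        induction i with
        | zero => exact fun _ => h0
        | succ i ih =>
          intro hi
          have := ih (by omega)
          have := step (i + 1) hi
          have := ne2 i hi
          omega
      have val (i : ℕ) : ∀ hi : i < k, (p ⟨0, by omega⟩ : ℕ) = p ⟨i, hi⟩ + i := by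
        induction i with
        | zero => simp
        | succ i ih => intro hi; have := all i hi; have := ih (by omega); omega
      right
      funext i
      have h1 := val i i.2
      have h2 := val (k - 1) (by omega)
      have h3 := (p ⟨0, by omega⟩).2
      ext
      rw [Fin.eta] at h1
      rw [Fin.val_rev]
      omega
  · left
    funext i
    ext
    have := (p i).2
    simp only [id]
    omega

/-- `Far.map` is applied to the inverse of σ at σ x: what is needed is that p reflects commutation,
so that neighbouring generators stay neighbours. -/
theorem actsLocally_id_or_rev (σ : bubbleSortGraph (k + 1) ≃g bubbleSortGraph (k + 1))
    (x : Equiv.Perm (Fin (k + 1))) : ActsLocally σ id x ∨ ActsLocally σ Fin.rev x := by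
  choose p hp using exists_map_adjSwap_mul σ x
  have hsymm (i : Fin k) : σ.symm (adjSwap (p i) * σ x) = adjSwap i * σ.symm (σ x) := by
    rw [← hp i, σ.symm_apply_apply, σ.symm_apply_apply]
  have hinj : Function.Injective p := by
    intro i j hij
    have := (hp i).trans ((congrArg (adjSwap · * σ x) hij).trans (hp j).symm)
    exact adjSwap_injective (mul_right_cancel (σ.injective this))
  rcases eq_id_or_rev hinj fun i j h => (h.map (hsymm i) (hsymm j)).1 with rfl | rfl
  · exact Or.inl hp
  · exact Or.inr hp

/-! ### Propagation of the local action -/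

/-- The action on generators is the same at the two ends of an edge, if that edge is not labelled
by the middle generator. -/
theorem ActsLocally.adjSwap_mul_of_rev_ne
    {σ : bubbleSortGraph (k + 1) ≃g bubbleSortGraph (k + 1)} {p : Fin k → Fin k}
    (hp : p = id ∨ p = Fin.rev) {x : Equiv.Perm (Fin (k + 1))} (h : ActsLocally σ p x) {i : Fin k}
    (hi : i.rev ≠ i) : ActsLocally σ p (adjSwap i * x) := by
  -- The edge labelled i leads back from s_i x to x, so both ends see the same image label; id and
  -- reversal differ at i unless i is the middle.
  have key {q : Fin k → Fin k} (hq : ActsLocally σ q (adjSwap i * x)) : q i = p i := by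
    have := hq i
    rw [adjSwap_mul_self_mul, h i, ← mul_assoc, eq_comm, mul_eq_right] at this
    apply adjSwap_injective
    apply mul_right_cancel (b := adjSwap (p i))
    rw [this, adjSwap_mul_self]
  rcases actsLocally_id_or_rev σ (adjSwap i * x) with hq | hq <;> rcases hp with rfl | rfl
  · exact hq
  · exact absurd (key hq).symm hi
  · exact absurd (key hq) hi
  · exact hq

theorem ActsLocally.adjSwap_mul {σ : bubbleSortGraph (k + 1) ≃g bubbleSortGraph (k + 1)}
    (hk : 2 ≤ k) {p : Fin k → Fin k}
    (hp : p = id ∨ p = Fin.rev) {x : Equiv.Perm (Fin (k + 1))} (h : ActsLocally σ p x) (i : Fin k) :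
    ActsLocally σ p (adjSwap i * x) := by
  by_cases hi : i.rev = i
  swap
  · exact h.adjSwap_mul_of_rev_ne hp hi
  obtain ⟨q, hq, hqx⟩ : ∃ q : Fin k → Fin k, (q = id ∨ q = Fin.rev) ∧
      ActsLocally σ q (adjSwap i * x) := by
    rcases actsLocally_id_or_rev σ (adjSwap i * x) with hq | hq
    exacts [⟨_, Or.inl rfl, hq⟩, ⟨_, Or.inr rfl, hq⟩]
  suffices q = p by rwa [← this]
  have hiv := congrArg Fin.val hi
  rw [Fin.val_rev] at hiv
  -- A middle generator exists only for odd k. For k ≥ 5 it commutes with s_0, and the square they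
  -- span carries the image of label 0 across. For k = 3 it commutes with no other generator.
  by_cases hk3 : k = 3
  · subst hk3
    obtain rfl : i = 1 := by ext; simp; omega
    have hq0 := hqx 0
    have hp0 := h.adjSwap_mul_of_rev_ne hp (i := 0) (by decide) 1
    have hp1 : p 1 = 1 := by rcases hp with rfl | rfl <;> rfl
    rw [h 1, hp1] at hq0
    rw [h 0, hp1] at hp0
    -- The two halves of the hexagon s_0 s_1 s_0 = s_1 s_0 s_1 at x have images ending at one
    -- vertex. The last labels a and b are unknown, but no choice of them closes the image when p 0
    -- ≠ q 0.
    obtain ⟨a, ha⟩ := exists_map_adjSwap_mul σ (adjSwap 1 * (adjSwap 0 * x)) 0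
    obtain ⟨b, hb⟩ := exists_map_adjSwap_mul σ (adjSwap 0 * (adjSwap 1 * x)) 1
    rw [hp0] at ha
    rw [hq0] at hb
    have braid : (adjSwap 0 : Equiv.Perm (Fin 4)) * adjSwap (1 : Fin 3) * adjSwap 0 =
        adjSwap 1 * adjSwap 0 * adjSwap 1 := by decide
    have hex : adjSwap a * adjSwap 1 * adjSwap (p 0) =
        adjSwap b * adjSwap (q 0) * adjSwap 1 := by
      apply mul_right_cancel (b := σ x)
      simp only [mul_assoc]
      rw [← ha, ← hb]
      simp only [← mul_assoc]
      rw [braid]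
    have no (a b : Fin 3) : adjSwap a * adjSwap 1 * adjSwap 0 ≠
          adjSwap b * adjSwap 2 * adjSwap 1 ∧
        adjSwap a * adjSwap 1 * adjSwap 2 ≠ adjSwap b * adjSwap 0 * adjSwap 1 := by
      revert a b
      decide
    rcases hp with rfl | rfl <;> rcases hq with rfl | rfl
    · rfl
    · exact absurd hex (no a b).1
    · exact absurd hex (no a b).2
    · rfl
  · have hfar : Far i ⟨0, by omega⟩ := by
      unfold Far
      simp only
      omega
    have h0 := (hfar.map (h i) (h _)).2
    have h1 := hqx ⟨0, by omega⟩
    rw [h0, h i] at h1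
    have h2 := congrArg Fin.val (adjSwap_injective (mul_right_cancel h1))
    rcases hp with rfl | rfl <;> rcases hq with rfl | rfl <;>
      simp only [id, Fin.val_rev] at h2
    · rfl
    · omega
    · omega
    · rfl

/-! ### Explicit form of the automorphisms -/

theorem conj_revPerm_adjSwap (i : Fin k) :
    Fin.revPerm * adjSwap i = adjSwap i.rev * (Fin.revPerm : Equiv.Perm (Fin (k + 1))) := by
  unfold adjSwap
  rw [Equiv.mul_swap_eq_swap_mul, Fin.revPerm_apply, Fin.revPerm_apply, Fin.rev_castSucc,
    Fin.rev_succ, Equiv.swap_comm]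

/-- Writing x as a word in the generators, σ replaces each s_i by s_(p i), which is conjugation by
b, and the word is then applied to σ 1. -/
theorem eq_conj_of_actsLocally {σ : bubbleSortGraph (k + 1) ≃g bubbleSortGraph (k + 1)}
    {p : Fin k → Fin k} {b : Equiv.Perm (Fin (k + 1))}
    (hb : ∀ i, b * adjSwap i = adjSwap (p i) * b) (h : ∀ x, ActsLocally σ p x)
    (x : Equiv.Perm (Fin (k + 1))) : σ x = b * x * (b⁻¹ * σ 1) := by
  have hx : x ∈ Submonoid.closure (Set.range fun i : Fin k => Equiv.swap i.castSucc i.succ) := by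
    rw [Equiv.Perm.mclosure_swap_castSucc_succ]
    trivial
  induction hx using Submonoid.closure_induction_left with
  | one => simp
  | mul_left s hs y hy ih =>
    obtain ⟨i, rfl⟩ := hs
    change σ (adjSwap i * y) = b * (adjSwap i * y) * _
    rw [h y i, ih]
    simp only [← mul_assoc, hb i]

theorem ActsLocally.of_one {σ : bubbleSortGraph (k + 1) ≃g bubbleSortGraph (k + 1)}
    (hk : 2 ≤ k) {p : Fin k → Fin k} (hp : p = id ∨ p = Fin.rev) (h : ActsLocally σ p 1)
    (x : Equiv.Perm (Fin (k + 1))) : ActsLocally σ p x := by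
  have hx : x ∈ Submonoid.closure (Set.range fun i : Fin k => Equiv.swap i.castSucc i.succ) := by
    rw [Equiv.Perm.mclosure_swap_castSucc_succ]
    trivial
  induction hx using Submonoid.closure_induction_left with
  | one => exact h
  | mul_left s hs y hy ih =>
    obtain ⟨i, rfl⟩ := hs
    exact ih.adjSwap_mul hk hp i

/-- Every automorphism of the bubble-sort graph is a right translation, possibly followed by left
multiplication with the order-reversing permutation. -/
theorem exists_eq_mul_mul_inv (hk : 2 ≤ k)
    (σ : bubbleSortGraph (k + 1) ≃g bubbleSortGraph (k + 1)) :
    ∃ a b : Equiv.Perm (Fin (k + 1)), (b = 1 ∨ b = Fin.revPerm) ∧ ∀ x, σ x = b * x * a⁻¹ := by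
  rcases actsLocally_id_or_rev σ 1 with h | h
  · refine ⟨(σ 1)⁻¹, 1, Or.inl rfl, fun x => ?_⟩
    have := eq_conj_of_actsLocally (b := 1) (by simp) (h.of_one hk (Or.inl rfl)) x
    simpa using this
  · refine ⟨(Fin.revPerm⁻¹ * σ 1)⁻¹, Fin.revPerm, Or.inr rfl, fun x => ?_⟩
    rw [inv_inv]
    exact eq_conj_of_actsLocally conj_revPerm_adjSwap (h.of_one hk (Or.inr rfl)) x

/-! ### The isomorphism with the direct product -/

theorem transpositionGraph_adj (x y : Fin (k + 1)) :
    (transpositionGraph (adjacentTranspositions (k + 1))).Adj x y ↔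
      x ≠ y ∧ ∃ i : Fin k, Equiv.swap x y = adjSwap i := by
  simp only [transpositionGraph, SimpleGraph.fromRel_adj, Equiv.swap_comm y x, or_self,
    mem_adjacentTranspositions_iff]

/-- Conjugating a transposition by b moves its two points by b, and b preserves adjacency in T(S).
This is why left multiplication by b preserves edges. -/
theorem exists_mul_adjSwap_eq (b : transpositionGraph (adjacentTranspositions (k + 1)) ≃g
    transpositionGraph (adjacentTranspositions (k + 1))) (i : Fin k) :
    ∃ j : Fin k, b.toEquiv * adjSwap i = adjSwap j * b.toEquiv := by
  have h : (transpositionGraph (adjacentTranspositions (k + 1))).Adj i.castSucc i.succ :=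
    (transpositionGraph_adj _ _).2 ⟨Fin.castSucc_lt_succ.ne, i, rfl⟩
  obtain ⟨-, j, hj⟩ := (transpositionGraph_adj _ _).1 (b.map_adj_iff.2 h)
  refine ⟨j, ?_⟩
  rw [adjSwap, Equiv.mul_swap_eq_swap_mul, ← hj]
  rfl

/-- Right multiplication by `a⁻¹` followed by left multiplication by an automorphism `b` of the
path `T(S)`, as an automorphism of the bubble-sort graph. -/
def mulMulInvIso (a : Equiv.Perm (Fin (k + 1)))
    (b : transpositionGraph (adjacentTranspositions (k + 1)) ≃g
      transpositionGraph (adjacentTranspositions (k + 1))) :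
    bubbleSortGraph (k + 1) ≃g bubbleSortGraph (k + 1) where
  toEquiv := (Equiv.mulLeft b.toEquiv).trans (Equiv.mulRight a⁻¹)
  map_rel_iff' := by
    intro x y
    simp only [Equiv.trans_apply, Equiv.coe_mulLeft, Equiv.coe_mulRight, bubbleSortGraph_adj]
    constructor
    · rintro ⟨i, hi⟩
      obtain ⟨j, hj⟩ := exists_mul_adjSwap_eq b⁻¹ i
      refine ⟨j, ?_⟩
      have hb : (b⁻¹).toEquiv = b.toEquiv⁻¹ := rfl
      rw [hb, inv_mul_eq_iff_eq_mul, ← mul_assoc, eq_mul_inv_iff_mul_eq] at hj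
      rw [← mul_assoc, ← mul_assoc] at hi
      have := mul_right_cancel hi
      rw [hj, mul_assoc] at this
      exact mul_left_cancel this
    · rintro ⟨i, rfl⟩
      obtain ⟨j, hj⟩ := exists_mul_adjSwap_eq b i
      exact ⟨j, by rw [← mul_assoc, ← mul_assoc, ← mul_assoc, hj]⟩

theorem mulMulInvIso_apply (a : Equiv.Perm (Fin (k + 1)))
    (b : transpositionGraph (adjacentTranspositions (k + 1)) ≃g
      transpositionGraph (adjacentTranspositions (k + 1))) (x : Equiv.Perm (Fin (k + 1))) :
    mulMulInvIso a b x = b.toEquiv * x * a⁻¹ :=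
  rfl

/-- The action of `S_n × Aut(T(S))` on the bubble-sort graph. -/
def mulMulInvHom (k : ℕ) : Equiv.Perm (Fin (k + 1)) ×
    (transpositionGraph (adjacentTranspositions (k + 1)) ≃g
      transpositionGraph (adjacentTranspositions (k + 1))) →*
    (bubbleSortGraph (k + 1) ≃g bubbleSortGraph (k + 1)) where
  toFun p := mulMulInvIso p.1 p.2
  map_one' := by
    refine RelIso.ext fun x => ?_
    rw [mulMulInvIso_apply]
    change 1 * x * 1⁻¹ = x
    simp
  map_mul' p q := by
    refine RelIso.ext fun x => ?_
    change p.2.toEquiv * q.2.toEquiv * x * (p.1 * q.1)⁻¹ =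
      p.2.toEquiv * (q.2.toEquiv * x * q.1⁻¹) * p.1⁻¹
    simp only [mul_inv_rev, mul_assoc]

/-- The order-reversing automorphism of the path `T(S)`. -/
def revIso (k : ℕ) : transpositionGraph (adjacentTranspositions (k + 1)) ≃g
    transpositionGraph (adjacentTranspositions (k + 1)) where
  toEquiv := Fin.revPerm
  map_rel_iff' := by
    have key (x y : Fin (k + 1))
        (h : (transpositionGraph (adjacentTranspositions (k + 1))).Adj x y) :
        (transpositionGraph (adjacentTranspositions (k + 1))).Adj x.rev y.rev := by
      rw [transpositionGraph_adj] at h ⊢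
      obtain ⟨hxy, i, hi⟩ := h
      refine ⟨fun h => hxy (Fin.rev_injective h), i.rev, ?_⟩
      rw [← Fin.revPerm_apply, ← Fin.revPerm_apply, Equiv.swap_apply_apply, hi,
        conj_revPerm_adjSwap, mul_inv_cancel_right]
    intro x y
    refine ⟨fun h => ?_, key x y⟩
    simpa using key _ _ h

theorem Equiv.Perm.eq_one_of_forall_commute {n : ℕ} (hn : 3 ≤ n) {a : Equiv.Perm (Fin n)}
    (h : ∀ x, Commute a x) : a = 1 := by
  ext1 i
  by_contra hi
  rw [Equiv.Perm.one_apply] at hi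
  obtain ⟨j, hj⟩ : ∃ j, j ∉ ({i, a i} : Finset (Fin n)) := by
    by_contra! hall
    have h1 := Finset.card_le_card (fun x _ => hall x : (Finset.univ : Finset (Fin n)) ⊆ _)
    have h2 := Finset.card_le_two (a := i) (b := a i)
    rw [Finset.card_univ, Fintype.card_fin] at h1
    omega
  -- With τ the transposition of a i and j, which fixes i, the values at i are a (τ i) = a i and τ
  -- (a i) = j.
  simp only [Finset.mem_insert, Finset.mem_singleton, not_or] at hj
  have := congrArg (fun f : Equiv.Perm (Fin n) => f i) (h (Equiv.swap (a i) j)).eq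
  simp only [Equiv.Perm.mul_apply, Equiv.swap_apply_left] at this
  rw [Equiv.swap_apply_of_ne_of_ne (Ne.symm hi) (Ne.symm hj.1)] at this
  exact hj.2 this.symm

theorem mulMulInvHom_bijective (hk : 2 ≤ k) : Function.Bijective (mulMulInvHom k) := by
  constructor
  · rw [injective_iff_map_eq_one]
    rintro ⟨a, b⟩ h
    have h' (x : Equiv.Perm (Fin (k + 1))) : b.toEquiv * x * a⁻¹ = x := by
      change mulMulInvHom k (a, b) x = x
      rw [h]
      rfl
    -- Evaluation at 1 gives b = a, and then a x a⁻¹ = x puts a in the centre.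
    have hab := h' 1
    rw [mul_one, mul_inv_eq_one] at hab
    have ha : a = 1 := by
      refine Equiv.Perm.eq_one_of_forall_commute (by omega) fun x => ?_
      have := h' x
      rwa [hab, mul_inv_eq_iff_eq_mul] at this
    subst ha
    have hb : b = 1 := RelIso.ext fun x => congrArg (fun f : Equiv.Perm (Fin (k + 1)) => f x) hab
    rw [hb]
    rfl
  · intro σ
    obtain ⟨a, b, rfl | rfl, h⟩ := exists_eq_mul_mul_inv hk σ
    · exact ⟨(a, 1), RelIso.ext fun x => (h x).symm⟩
    · exact ⟨(a, revIso k), RelIso.ext fun x => (h x).symm⟩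

/-! ### The labelling by cycles for n ≥ 4 -/

theorem coe_cycleRange_symm (i j : Fin (k + 1)) (hj : (j : ℕ) ≠ 0) :
    (i.cycleRange.symm j : ℕ) = if j ≤ i then (j : ℕ) - 1 else j := by
  obtain ⟨j, rfl⟩ := Fin.exists_succ_eq.2 (fun h => hj (by simp [h]) : j ≠ 0)
  rw [Fin.cycleRange_symm_succ, Fin.succAbove]
  simp only [Fin.lt_def, Fin.le_def, Fin.val_castSucc, Fin.val_succ, apply_ite Fin.val]
  split_ifs <;> omega

theorem bubbleSortLabelling_eq_one_iff {n : ℕ} (x : Equiv.Perm (Fin n)) :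
    bubbleSortLabelling n x = 1 ↔ ∃ i : Fin n, 1 ≤ (i : ℕ) ∧ x = Fin.cycleRange i := by
  unfold bubbleSortLabelling
  split_ifs with h <;> simp [h]

theorem isDistinguishingLabelling_bubbleSortLabelling (hk : 3 ≤ k) :
    IsDistinguishingLabelling (bubbleSortGraph (k + 1)) 2 (bubbleSortLabelling (k + 1)) := by
  refine ⟨fun x => ?_, fun σ hσ => ?_⟩
  · unfold bubbleSortLabelling
    split_ifs <;> simp
  by_contra! hlab
  apply hσ
  obtain ⟨a, b, hb, h⟩ := exists_eq_mul_mul_inv (by omega) σ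
  -- Invariance gives b c_i a⁻¹ = c_j. It is used in the inverted form a c_i⁻¹ b⁻¹ = c_j⁻¹, since
  -- c_j⁻¹ t is t - 1 or t for every t ≥ 1.
  have hcyc (i : Fin (k + 1)) (hi : 1 ≤ (i : ℕ)) : ∃ j : Fin (k + 1), 1 ≤ (j : ℕ) ∧
      ∀ t, a (i.cycleRange.symm (b⁻¹ t)) = j.cycleRange.symm t := by
    obtain ⟨j, hj, hij⟩ := (bubbleSortLabelling_eq_one_iff (σ i.cycleRange)).1
      ((hlab _).symm.trans ((bubbleSortLabelling_eq_one_iff _).2 ⟨i, hi, rfl⟩))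
    refine ⟨j, hj, fun t => ?_⟩
    rw [Equiv.eq_symm_apply, ← hij, h]
    change b (i.cycleRange (a.symm (a (i.cycleRange.symm (b.symm t))))) = t
    simp only [Equiv.symm_apply_apply, Equiv.apply_symm_apply]
  have ainj {x y : Fin (k + 1)} (e : (a x : ℕ) = a y) : (x : ℕ) = y :=
    congrArg Fin.val (a.injective (Fin.ext e))
  rcases hb with rfl | rfl
  · simp only [inv_one, Equiv.Perm.one_apply] at hcyc
    -- `a` preserves each of the pairs `{t - 1, t}`
    have hpair (i t : Fin (k + 1)) (hi : 1 ≤ (i : ℕ)) (ht : 1 ≤ (t : ℕ)) :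
        (a (i.cycleRange.symm t) : ℕ) = t - 1 ∨ (a (i.cycleRange.symm t) : ℕ) = t := by
      obtain ⟨j, -, hj⟩ := hcyc i hi
      rw [hj, coe_cycleRange_symm _ _ (by omega)]
      split_ifs <;> simp
    -- The shortest cycle fixes every t ≥ 2, while the longest one, used in `hpred`, shifts every
    -- point. The two constraints on a t meet only in t.
    have hself (t : Fin (k + 1)) (ht : 2 ≤ (t : ℕ)) : (a t : ℕ) = t - 1 ∨ (a t : ℕ) = t := by
      have := hpair ⟨1, by omega⟩ t le_rfl (by omega)
      rwa [show Equiv.symm (Fin.cycleRange (⟨1, by omega⟩ : Fin (k + 1))) t = t from Fin.ext (by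
        rw [coe_cycleRange_symm _ _ (by omega), if_neg]
        rw [Fin.le_def]
        simp only
        omega)] at this
    have hpred (t : ℕ) (ht : t + 1 < k + 1) : (a ⟨t, by omega⟩ : ℕ) = t ∨
        (a ⟨t, by omega⟩ : ℕ) = t + 1 := by
      have := hpair (Fin.last k) ⟨t + 1, ht⟩ (by simp; omega) (by simp)
      rwa [show Equiv.symm (Fin.cycleRange (Fin.last k)) ⟨t + 1, ht⟩ = ⟨t, by omega⟩ from Fin.ext (by
        rw [coe_cycleRange_symm _ _ (by simp), if_pos (Fin.le_last _)]
        simp)] at this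
    -- All the inverse cycles send 1 to 0.
    have hzero : (a 0 : ℕ) = 0 := by
      obtain ⟨j, hj1, hj⟩ := hcyc ⟨1, by omega⟩ le_rfl
      have h1 := coe_cycleRange_symm ⟨1, by omega⟩ (⟨1, by omega⟩ : Fin (k + 1)) (by simp)
      have h2 := coe_cycleRange_symm j (⟨1, by omega⟩ : Fin (k + 1)) (by simp)
      rw [if_pos le_rfl] at h1
      rw [if_pos (Fin.le_def.2 hj1), ← hj, show Equiv.symm _ _ = (0 : Fin (k + 1)) from Fin.ext h1] at h2
      exact h2
    have hmid (t : ℕ) (ht : 2 ≤ t) (htk : t < k) : (a ⟨t, by omega⟩ : ℕ) = t := by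
      have h1 := hself ⟨t, by omega⟩ ht
      have h2 := hpred t (by omega)
      simp only at h1
      omega
    have ha : a = 1 := by
      ext t
      rw [Equiv.Perm.one_apply]
      rcases Nat.lt_or_ge (t : ℕ) 2 with ht | ht
      · rcases Nat.eq_zero_or_pos (t : ℕ) with h0 | h0
        · rw [show t = 0 from Fin.ext h0, hzero]
          rfl
        · have h1 : (t : ℕ) = 1 := by omega
          have h2 := hpred t (by omega)
          rw [Fin.eta] at h2
          refine h2.resolve_right fun h3 => ?_
          -- The value 2 is already taken, because 2 < k makes 2 a fixed point.
          have := ainj (y := ⟨2, by omega⟩) (by rw [h3, hmid 2 le_rfl (by omega), h1])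
          simp only at this
          omega
      · rcases Nat.lt_or_ge (t : ℕ) k with htk | htk
        · exact hmid t ht htk
        · refine (hself t ht).resolve_left fun h3 => ?_
          have := ainj (h3.trans (hmid (t - 1) (by omega) (by omega)).symm)
          simp only at this
          omega
    refine RelIso.ext fun x => ?_
    rw [h, ha]
    simp
  · -- `a` maps all nonzero points to the last two
    have hlast (i : Fin (k + 1)) (hi : 1 ≤ (i : ℕ)) : (a i : ℕ) = k - 1 ∨ (a i : ℕ) = k := by
      obtain ⟨j, -, hj⟩ := hcyc i hi
      have h1 := hj (Fin.last k)
      rw [show (Fin.revPerm⁻¹ : Equiv.Perm (Fin (k + 1))) (Fin.last k) = 0 from Fin.rev_last k,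
        Fin.cycleRange_symm_zero] at h1
      rw [h1, coe_cycleRange_symm _ _ (by simp; omega), Fin.val_last]
      split_ifs <;> simp
    -- Since k ≥ 3, the three points 1, 2, 3 would share two values.
    have h1 := hlast ⟨1, by omega⟩ le_rfl
    have h2 := hlast ⟨2, by omega⟩ (by simp)
    have h3 := hlast ⟨3, by omega⟩ (by simp)
    have h12 := mt (@ainj ⟨1, by omega⟩ ⟨2, by omega⟩) (by simp)
    have h13 := mt (@ainj ⟨1, by omega⟩ ⟨3, by omega⟩) (by simp)
    have h23 := mt (@ainj ⟨2, by omega⟩ ⟨3, by omega⟩) (by simp)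
    omega

/-! ### The case n = 3 and the distinguishing number -/

/-- The graph is a hexagon. The cycle labelling fails here, as any two vertices of a hexagon are
preserved by some reflection; label 1 goes instead to two adjacent vertices and the antipode of one
of them, a set without symmetry. -/
theorem exists_isDistinguishingLabelling_three :
    ∃ φ, IsDistinguishingLabelling (bubbleSortGraph 3) 2 φ := by
  let φ (x : Equiv.Perm (Fin 3)) : ℕ :=
    if x = 1 ∨ x = Equiv.swap 0 1 ∨ x = Equiv.swap 0 2 then 1 else 2
  have key : ∀ a b : Equiv.Perm (Fin 3), (b = 1 ∨ b = Fin.revPerm) →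
      (∀ x, φ x = φ (b * x * a⁻¹)) → ∀ x, b * x * a⁻¹ = x := by
    decide
  refine ⟨φ, fun x => ?_, fun σ hσ => ?_⟩
  · simp only [φ]
    split_ifs <;> simp
  · by_contra! hlab
    obtain ⟨a, b, hb, h⟩ := exists_eq_mul_mul_inv le_rfl σ
    exact hσ (RelIso.ext fun x => (h x).trans (key a b hb (fun x => by rw [← h, ← hlab]) x))

theorem distinguishingNumber_bubbleSortGraph (hk : 2 ≤ k) :
    distinguishingNumber (bubbleSortGraph (k + 1)) = 2 := by
  refine IsLeast.csInf_eq ⟨?_, ?_⟩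
  · rcases hk.eq_or_lt with rfl | hk
    · exact exists_isDistinguishingLabelling_three
    · exact ⟨_, isDistinguishingLabelling_bubbleSortLabelling hk⟩
  · rintro r ⟨φ, hφ, hσ⟩
    by_contra! hr
    -- With at most one label available every automorphism preserves the labelling, so one
    -- nontrivial right translation suffices.
    have hne : mulMulInvIso (adjSwap (⟨0, by omega⟩ : Fin k)) 1 ≠ 1 := by
      intro h
      have h1 := DFunLike.congr_fun h 1
      rw [mulMulInvIso_apply] at h1
      change 1 * 1 * _ = (1 : Equiv.Perm (Fin (k + 1))) at h1
      rw [one_mul, one_mul, inv_eq_one] at h1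
      exact adjSwap_ne_one _ h1
    obtain ⟨x, hx⟩ := hσ _ hne
    have h1 := Finset.mem_Icc.1 (hφ x)
    have h2 := Finset.mem_Icc.1 (hφ (mulMulInvIso (adjSwap (⟨0, by omega⟩ : Fin k)) 1 x))
    omega

theorem mainTheorem4 (n : ℕ) (hn : 3 ≤ n) :
    distinguishingNumber (bubbleSortGraph n) = 2 ∧
    (4 ≤ n → IsDistinguishingLabelling (bubbleSortGraph n) 2 (bubbleSortLabelling n)) ∧
    ∃ Φ : Equiv.Perm (Fin n) ×
          (transpositionGraph (adjacentTranspositions n) ≃g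
            transpositionGraph (adjacentTranspositions n)) ≃*
          (bubbleSortGraph n ≃g bubbleSortGraph n),
      ∀ (a : Equiv.Perm (Fin n))
        (b : transpositionGraph (adjacentTranspositions n) ≃g
          transpositionGraph (adjacentTranspositions n))
        (x : Equiv.Perm (Fin n)),
        Φ (a, b) x = b.toEquiv * x * a⁻¹ := by
  obtain ⟨k, rfl⟩ : ∃ k, n = k + 1 := ⟨n - 1, by omega⟩
  refine ⟨distinguishingNumber_bubbleSortGraph (by omega),
    fun h => isDistinguishingLabelling_bubbleSortLabelling (by omega),
    MulEquiv.ofBijective (mulMulInvHom k) (mulMulInvHom_bijective (by omega)),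
    fun a b x => mulMulInvIso_apply a b x⟩
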